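/- An involution lattice is a lattice $L$ with a unary operation $\cdot'$ such that $a\le b$ implies $b'\le a'$, and $a''=a$, for all $a,b\in L$; a pseudo-Kleene algebra is an involution lattice that has a least and a greatest element and satisfies $a\wedge a'\le b\vee b'$ for all $a,b$. Write $\mathrm{Filt}(L)$ and $\mathrm{Id}(L)$ for the sets of (nonempty) filters and (nonempty) ideals of $L$, $\mathrm{Con}(L)$ for the set of congruences of the underlying lattice, and $\mathrm{Con}_{\mathbb I}(L)$ for the set of those $\theta\in\mathrm{Con}(L)$ that preserve the involution, i.e. $(a,b)\in\theta$ implies $(a',b')\in\theta$. Theorem. Let $\nu$ be an infinite cardinal, let $\kappa$ be a cardinal with $2\le\kappa\le\nu$ or $\kappa=2^{\nu}$, and let $\mu\in\{\nu,2^{\nu}\}$. Then there is a pseudo-Kleene algebra (in particular, a bounded lattice, and a bounded involution lattice) $L$ with $|L|=\nu$, $|\mathrm{Filt}(L)|=|\mathrm{Id}(L)|=\mu$ and $|\mathrm{Con}(L)|=|\mathrm{Con}_{\mathbb I}(L)|=\kappa$, such that moreover, if $\kappa\le\nu$, then $\mathrm{Con}_{\mathbb I}(L)=\mathrm{Con}(L)$.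 -/

import Mathlib

universe u

/-- An involution lattice: a lattice with an order-reversing operation `invol` that is its own
inverse. -/
class InvolutionLattice (L : Type u) extends Lattice L where
  /-- The involution. -/
  invol : L → L
  invol_le_invol : ∀ a b : L, a ≤ b → invol b ≤ invol a
  invol_invol : ∀ a : L, invol (invol a) = a

/-- A bounded involution lattice: an involution lattice with bottom and top elements. -/
class BoundedInvolutionLattice (L : Type u) extends InvolutionLattice L, BoundedOrder L

/-- A pseudo-Kleene algebra: a bounded involution lattice in which `a ⊓ a' ≤ b ⊔ b'` for all
`a` and `b`. -/
class PseudoKleeneAlgebra (L : Type u) extends BoundedInvolutionLattice L where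
  inf_invol_le_sup_invol : ∀ a b : L, a ⊓ invol a ≤ b ⊔ invol b

/-- The set of congruences of the involution lattice `L`, as a subset of the set `LatticeCon L` of
congruences of its lattice reduct: those lattice congruences that are also compatible with the
involution. -/
def involutionCon (L : Type u) [InvolutionLattice L] : Set (LatticeCon L) :=
  {θ | ∀ a b : L, θ.r a b → θ.r (InvolutionLattice.invol a) (InvolutionLattice.invol b)}

/-! The involution exchanges filters and ideals, so only ideals are counted. Let |X| = ν. For κ =
2^ν, two algebras have a separate involution-preserving congruence for each subset of X: the
finite-cofinite algebra of X, with 2^ν ideals, and a fan of two-element chains, which satisfies the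
ascending chain condition and so has only the ν principal ideals. For κ ≤ ν, copies of an
ortholattice K are nested around a core along a well-ordered set I with greatest element. Everything
inside layer i is a complement, relative to the bounds of that layer, of each of its other elements.
Hence a congruence identifying two distinct elements collapses the outer one's layer together with
its inside (`mem_collapsed_of_rel`, `mem_collapsed_of_rel_layer`). Congruences therefore correspond
to lower sets of I (`con_collapsed`), of which there are |I| + 1 (`mk_lowerSet`), and all preserve
the involution. So I fixes κ, while K fixes μ: a fan of one-element chains gives ν, the
finite-cofinite algebra 2^ν. By `ideal_eq_principal_or`, if K has only principal ideals, nesting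
creates at most one further ideal per lower set. -/

open Cardinal Order

/-! ### Cardinal bounds for congruences, ideals and filters -/

section Counting

theorem LatticeCon.ext_r {L : Type u} [Lattice L] {θ ψ : LatticeCon L}
    (h : ∀ a b, θ.r a b ↔ ψ.r a b) : θ = ψ := by
  obtain ⟨s, _, _⟩ := θ
  obtain ⟨t, _, _⟩ := ψ
  obtain rfl : s = t := Setoid.ext h
  rfl

theorem mk_latticeCon_le (L : Type u) [Lattice L] (hL : ℵ₀ ≤ #L) : #(LatticeCon L) ≤ 2 ^ #L := by
  have h : #(LatticeCon L) ≤ #(Set (L × L)) := by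
    refine mk_le_of_injective (f := fun θ => {p : L × L | θ.r p.1 p.2}) fun θ ψ h => ?_
    exact LatticeCon.ext_r fun a b => Set.ext_iff.1 h (a, b)
  rwa [mk_set, mk_prod, lift_id, mul_eq_self hL] at h

theorem mk_ideal_le (L : Type u) [Lattice L] : #(Ideal L) ≤ 2 ^ #L := by
  rw [← mk_set]
  exact mk_le_of_injective (f := fun J : Ideal L => (J : Set L)) SetLike.coe_injective

theorem mk_le_mk_ideal (L : Type u) [Lattice L] : #L ≤ #(Ideal L) := by
  refine mk_le_of_injective (f := Ideal.principal) fun a b h => ?_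
  apply le_antisymm
  · rw [← Ideal.mem_principal, ← h, Ideal.mem_principal]
  · rw [← Ideal.mem_principal, h, Ideal.mem_principal]

/-- The ideal generated by the image of an ideal under a join-preserving map. -/
def Order.Ideal.mapSup {K L : Type u} [Lattice K] [Lattice L] (f : K → L)
    (hf : ∀ a b, f (a ⊔ b) = f a ⊔ f b) (J : Ideal K) : Ideal L where
  carrier := {x | ∃ a ∈ J, x ≤ f a}
  lower' := fun _ _ hyx ⟨a, ha, hx⟩ => ⟨a, ha, hyx.trans hx⟩
  nonempty' := J.nonempty.imp' f fun a ha => ⟨a, ha, le_rfl⟩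
  directed' := fun x ⟨a, ha, hx⟩ y ⟨b, hb, hy⟩ =>
    ⟨x ⊔ y, ⟨a ⊔ b, Ideal.sup_mem ha hb, by rw [hf]; exact sup_le_sup hx hy⟩,
      le_sup_left, le_sup_right⟩

/-- An ideal is recovered as the preimage of the ideal its image generates. -/
theorem mk_ideal_le_of_sup_embedding {K L : Type u} [Lattice K] [Lattice L] (f : K → L)
    (hf : ∀ a b, f (a ⊔ b) = f a ⊔ f b) (hle : ∀ a b, f a ≤ f b → a ≤ b) :
    #(Ideal K) ≤ #(Ideal L) := by
  have mem (J : Ideal K) (a : K) : f a ∈ J.mapSup f hf ↔ a ∈ J :=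
    ⟨fun ⟨b, hb, h⟩ => J.lower (hle a b h) hb, fun h => ⟨a, h, le_rfl⟩⟩
  refine mk_le_of_injective (f := Ideal.mapSup f hf) fun I J h => ?_
  refine SetLike.ext fun a => ?_
  rw [← mem I, h, mem J]

/-- In a lattice satisfying the ascending chain condition, every ideal is principal. -/
theorem Order.Ideal.exists_eq_principal {L : Type u} [Lattice L] [WellFoundedGT L] (J : Ideal L) :
    ∃ a, J = Ideal.principal a := by
  obtain ⟨m, hm, hmax⟩ := wellFounded_gt.has_min (J : Set L) J.nonempty
  refine ⟨m, SetLike.ext fun x => ⟨fun hx => ?_, fun hx => J.lower hx hm⟩⟩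
  have h := hmax (m ⊔ x) (Ideal.sup_mem hm hx)
  rw [Ideal.mem_principal]
  by_contra hxm
  exact h (left_lt_sup.2 hxm)

theorem mk_pfilter_eq_mk_ideal (L : Type u) [InvolutionLattice L] : #(PFilter L) = #(Ideal L) := by
  have hi := InvolutionLattice.invol_invol (L := L)
  have hle := InvolutionLattice.invol_le_invol (L := L)
  let e : L ≃o Lᵒᵈ :=
    { toFun := fun a => OrderDual.toDual (InvolutionLattice.invol a)
      invFun := fun a => InvolutionLattice.invol (OrderDual.ofDual a)
      left_inv := hi
      right_inv := hi
      map_rel_iff' := fun {a b} => ⟨fun h => hi a ▸ hi b ▸ hle _ _ h, hle a b⟩ }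
  have h : #(Ideal L) = #(Ideal Lᵒᵈ) := le_antisymm
    (mk_ideal_le_of_sup_embedding e (fun a b => map_sup e a b) fun a b => e.le_iff_le.1)
    (mk_ideal_le_of_sup_embedding e.symm (fun a b => map_sup e.symm a b)
      fun a b => e.symm.le_iff_le.1)
  rw [h]
  exact mk_congr ⟨PFilter.dual, PFilter.mk, fun _ => rfl, fun _ => rfl⟩

/-- A proper lower set of a well-order is the initial segment below the least element it misses; the
extra 1 counts the whole set. -/
theorem mk_lowerSet (W : Type u) [LinearOrder W] [WellFoundedLT W] :
    #(LowerSet W) = #W + 1 := by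
  rw [← mk_option]
  refine (mk_congr (Equiv.ofBijective
    (fun o : Option W => o.elim (⊤ : LowerSet W) LowerSet.Iio) ⟨?_, ?_⟩)).symm
  · have key (a : W) : (⊤ : LowerSet W) ≠ LowerSet.Iio a := fun h => by
      have : a ∈ LowerSet.Iio a := by rw [← h]; exact LowerSet.mem_top
      simp at this
    rintro (_ | a) (_ | b) h
    · rfl
    · exact (key b h).elim
    · exact (key a h.symm).elim
    · exact congrArg some (Set.Iio_injective (congrArg SetLike.coe h))
  · intro U
    by_cases h : ∃ a, a ∉ U
    · obtain ⟨a, ha, hmin⟩ := wellFounded_lt.has_min {a | a ∉ U} h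
      refine ⟨some a, SetLike.ext fun b => ?_⟩
      simp only [Option.elim_some, LowerSet.mem_Iio_iff]
      refine ⟨fun hb => by_contra fun hbU => hmin b hbU hb, fun hb => ?_⟩
      by_contra hab
      exact ha (U.lower (not_lt.1 hab) hb)
    · push Not at h
      exact ⟨none, SetLike.ext fun b => by simp [h]⟩

end Counting

/-! ### Reducing meets to joins and the involution -/

/-- A pseudo-Kleene algebra built from a bounded order with binary joins and an antitone
involution. -/
@[reducible]
def PseudoKleeneAlgebra.ofSup {L : Type u} [PartialOrder L] [BoundedOrder L] (sup : L → L → L)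
    (invol : L → L) (le_sup_left : ∀ a b, a ≤ sup a b) (le_sup_right : ∀ a b, b ≤ sup a b)
    (sup_le : ∀ a b c, a ≤ c → b ≤ c → sup a b ≤ c)
    (invol_le : ∀ a b, a ≤ b → invol b ≤ invol a) (invol_invol : ∀ a, invol (invol a) = a)
    (kleene : ∀ a b, invol (sup (invol a) (invol (invol a))) ≤ sup b (invol b)) :
    PseudoKleeneAlgebra L where
  sup := sup
  le_sup_left := le_sup_left
  le_sup_right := le_sup_right
  sup_le := sup_le
  inf a b := invol (sup (invol a) (invol b))
  inf_le_left a b := by simpa [invol_invol] using invol_le _ _ (le_sup_left (invol a) (invol b))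
  inf_le_right a b := by simpa [invol_invol] using invol_le _ _ (le_sup_right (invol a) (invol b))
  le_inf a b c hab hac := by
    simpa [invol_invol] using invol_le _ _ (sup_le _ _ _ (invol_le _ _ hab) (invol_le _ _ hac))
  invol := invol
  invol_le_invol := invol_le
  invol_invol := invol_invol
  le_top := fun _ => OrderTop.le_top _
  bot_le := fun _ => OrderBot.bot_le _
  inf_invol_le_sup_invol := kleene

theorem InvolutionLattice.invol_sup_invol {L : Type u} [InvolutionLattice L] (a b : L) :
    invol (invol a ⊔ invol b) = a ⊓ b := by
  apply le_antisymm
  · apply le_inf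
    · simpa [invol_invol] using invol_le_invol _ _ (le_sup_left : invol a ≤ invol a ⊔ invol b)
    · simpa [invol_invol] using invol_le_invol _ _ (le_sup_right : invol b ≤ invol a ⊔ invol b)
  · rw [← invol_invol (a ⊓ b)]
    exact invol_le_invol _ _
      (sup_le (invol_le_invol _ _ inf_le_left) (invol_le_invol _ _ inf_le_right))

/-- An equivalence relation on an involution lattice that is compatible with joins and with the
involution is a lattice congruence. -/
def LatticeCon.ofSupInvol {L : Type u} [InvolutionLattice L] (s : Setoid L)
    (sup : ∀ ⦃w x y z⦄, s.r w x → s.r y z → s.r (w ⊔ y) (x ⊔ z))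
    (invol : ∀ ⦃x y⦄, s.r x y → s.r (InvolutionLattice.invol x) (InvolutionLattice.invol y)) :
    LatticeCon L where
  toSetoid := s
  sup h h' := sup h h'
  inf {w x y z} h h' := by
    rw [← InvolutionLattice.invol_sup_invol w, ← InvolutionLattice.invol_sup_invol x]
    exact invol (sup (invol h) (invol h'))

theorem LatticeCon.ofSupInvol_mem {L : Type u} [InvolutionLattice L] {s : Setoid L}
    {sup : ∀ ⦃w x y z⦄, s.r w x → s.r y z → s.r (w ⊔ y) (x ⊔ z)}
    {invol : ∀ ⦃x y⦄, s.r x y → s.r (InvolutionLattice.invol x) (InvolutionLattice.invol y)} :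
    LatticeCon.ofSupInvol s sup invol ∈ involutionCon L :=
  fun _ _ h => invol h

/-- The pair `p x`, `q x` tests membership of `x`, so `S` can be read off its congruence. -/
theorem two_pow_le_mk_involutionCon {L X : Type u} [InvolutionLattice L]
    (con : Set X → LatticeCon L) (hcon : ∀ S, con S ∈ involutionCon L) (p q : X → L)
    (h : ∀ S x, (con S).r (p x) (q x) ↔ x ∈ S) : 2 ^ #X ≤ #(involutionCon L) := by
  rw [← mk_set]
  refine mk_le_of_injective (f := fun S => (⟨con S, hcon S⟩ : involutionCon L))
    fun S T hST => Set.ext fun x => ?_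
  have hST : con S = con T := congrArg Subtype.val hST
  rw [← h S, ← h T, hST]

open InvolutionLattice (invol invol_invol invol_le_invol invol_sup_invol)

/-! ### The finite-cofinite algebra: many ideals, many congruences -/

section FiniteCofinite

/-- The Boolean algebra of finite and cofinite subsets of a type. -/
def finiteCofinite (X : Type u) : BooleanSubalgebra (Set X) where
  carrier := {s | s.Finite ∨ sᶜ.Finite}
  supClosed' := by
    rintro s (hs | hs) t (ht | ht)
    · exact .inl (hs.union ht)
    all_goals refine .inr (?_ : (s ∪ t)ᶜ.Finite); rw [Set.compl_union]
    · exact ht.subset Set.inter_subset_right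
    · exact hs.subset Set.inter_subset_left
    · exact hs.subset Set.inter_subset_left
  infClosed' := by
    rintro s (hs | hs) t (ht | ht)
    · exact .inl (hs.subset Set.inter_subset_left)
    · exact .inl (hs.subset Set.inter_subset_left)
    · exact .inl (ht.subset Set.inter_subset_right)
    · refine .inr (?_ : (s ∩ t)ᶜ.Finite)
      rw [Set.compl_inter]
      exact hs.union ht
  compl_mem' := by
    rintro s (hs | hs)
    · exact .inr (by rwa [compl_compl])
    · exact .inl hs
  bot_mem' := .inl Set.finite_empty

/-- A Boolean algebra is a pseudo-Kleene algebra, with complementation as involution. -/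
@[reducible]
def PseudoKleeneAlgebra.ofBooleanAlgebra (B : Type u) [BooleanAlgebra B] :
    PseudoKleeneAlgebra B where
  invol := compl
  invol_le_invol _ _ := compl_le_compl
  invol_invol := compl_compl
  inf_invol_le_sup_invol a b := by simp

instance (X : Type u) : PseudoKleeneAlgebra (finiteCofinite X) := .ofBooleanAlgebra _

variable {X : Type u}

theorem finiteCofinite_singleton_mem (x : X) : {x} ∈ finiteCofinite X :=
  .inl (Set.finite_singleton x)

theorem mk_finiteCofinite (X : Type u) [Infinite X] : #(finiteCofinite X) = #X := by
  apply le_antisymm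
  · have h : #(finiteCofinite X) ≤ #(Finset X ⊕ Finset X) := by
      refine mk_le_of_surjective (f := Sum.elim
        (fun s => (⟨s, .inl s.finite_toSet⟩ : finiteCofinite X))
        (fun s => ⟨(s : Set X)ᶜ, .inr (by rw [compl_compl]; exact s.finite_toSet)⟩)) ?_
      rintro ⟨s, hs | hs⟩
      · exact ⟨.inl hs.toFinset, Subtype.ext hs.coe_toFinset⟩
      · exact ⟨.inr hs.toFinset, Subtype.ext (by simp)⟩
    simpa [mk_finset_of_infinite, add_eq_self (aleph0_le_mk X)] using h
  · exact mk_le_of_injective (f := fun x => (⟨{x}, finiteCofinite_singleton_mem x⟩ :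
      finiteCofinite X)) fun x y h => Set.singleton_injective (congrArg Subtype.val h)

theorem mk_ideal_finiteCofinite (X : Type u) [Infinite X] :
    #(Ideal (finiteCofinite X)) = 2 ^ #X := by
  apply le_antisymm
  · simpa only [mk_finiteCofinite] using mk_ideal_le (finiteCofinite X)
  · rw [← mk_set]
    -- The finite subsets of `S` form an ideal whose singletons recover `S`.
    let J (S : Set X) : Ideal (finiteCofinite X) :=
      { carrier := {s | s.1.Finite ∧ s.1 ⊆ S}
        lower' := fun s t hts ⟨hs, hsS⟩ =>
          ⟨hs.subset hts, Set.Subset.trans hts hsS⟩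
        nonempty' := ⟨⊥, Set.finite_empty, Set.empty_subset S⟩
        directed' := fun s ⟨hs, hsS⟩ t ⟨ht, htS⟩ =>
          ⟨s ⊔ t, ⟨hs.union ht, Set.union_subset hsS htS⟩, le_sup_left, le_sup_right⟩ }
    have mem (S : Set X) (x : X) : ⟨{x}, finiteCofinite_singleton_mem x⟩ ∈ J S ↔ x ∈ S :=
      ⟨fun h => h.2 rfl, fun h => ⟨Set.finite_singleton x, Set.singleton_subset_iff.2 h⟩⟩
    exact mk_le_of_injective (f := J) fun S T h => Set.ext fun x => by rw [← mem S, h, mem T]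

/-- The congruence of the finite-cofinite algebra that forgets the elements of `S`. -/
def finiteCofiniteCon (S : Set X) : LatticeCon (finiteCofinite X) :=
  .ofSupInvol
    { r := fun s t => ∀ x ∉ S, x ∈ s.1 ↔ x ∈ t.1
      iseqv := ⟨fun _ _ _ => Iff.rfl, fun h x hx => (h x hx).symm,
        fun h h' x hx => (h x hx).trans (h' x hx)⟩ }
    (fun _ _ _ _ h h' x hx => or_congr (h x hx) (h' x hx))
    (fun _ _ h x hx => not_congr (h x hx))

theorem two_pow_le_mk_involutionCon_finiteCofinite (X : Type u) :
    2 ^ #X ≤ #(involutionCon (finiteCofinite X)) := by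
  refine two_pow_le_mk_involutionCon finiteCofiniteCon
    (fun S => LatticeCon.ofSupInvol_mem)
    (fun x => ⟨{x}, finiteCofinite_singleton_mem x⟩) (fun _ => ⊥) fun S x => ?_
  refine ⟨fun h => by_contra fun hx => (h x hx).1 rfl, fun hx y hy => ⟨fun h => ?_, False.elim⟩⟩
  exact hy (Set.mem_singleton_iff.1 h ▸ hx)

end FiniteCofinite

/-! ### Fans: few ideals -/

section Fan

/-- The elements of a fan: the disjoint union of copies of `C` indexed by `Y`, together with a
least and a greatest element. -/
inductive Fan (Y : Type u) (C : Type) : Type u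
  | bot : Fan Y C
  | mid : Y → C → Fan Y C
  | top : Fan Y C

namespace Fan

variable {Y : Type u} {C : Type}

instance [LE C] : LE (Fan Y C) where
  le
    | bot, _ => True
    | _, top => True
    | mid y c, mid z d => y = z ∧ c ≤ d
    | _, _ => False

section LE
variable [LE C] (x : Fan Y C) (y z : Y) (c d : C)

@[simp] theorem bot_le' : bot ≤ x := by cases x <;> trivial
@[simp] theorem le_top' : x ≤ top := by cases x <;> trivial
@[simp] theorem mid_le_mid : mid y c ≤ mid z d ↔ y = z ∧ c ≤ d := Iff.rfl
@[simp] theorem not_mid_le_bot : ¬ mid y c ≤ bot := id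
@[simp] theorem not_top_le_bot : ¬ (top : Fan Y C) ≤ bot := id
@[simp] theorem not_top_le_mid : ¬ top ≤ mid y c := id

end LE

instance [PartialOrder C] : PartialOrder (Fan Y C) where
  le_refl x := by cases x <;> simp
  le_trans := by
    rintro (_ | ⟨a, c⟩ | _) (_ | ⟨b, d⟩ | _) (_ | ⟨e, f⟩ | _) <;> simp
    rintro rfl h rfl h'
    exact ⟨rfl, h.trans h'⟩
  le_antisymm x y hxy hyx := by
    cases x <;> cases y <;> simp_all
    exact le_antisymm hxy.2 hyx

instance [LE C] : BoundedOrder (Fan Y C) where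
  bot := bot
  bot_le := bot_le'
  top := top
  le_top := le_top'

open Classical in
/-- The join in a fan. -/
noncomputable def sup [LinearOrder C] : Fan Y C → Fan Y C → Fan Y C
  | bot, x => x
  | x, bot => x
  | top, _ => top
  | _, top => top
  | mid y c, mid z d => if y = z then mid y (max c d) else top

/-- The involution of a fan induced by involutions of the index type and of the chain. -/
def invol (σ : Y → Y) (τ : C → C) : Fan Y C → Fan Y C
  | bot => top
  | top => bot
  | mid y c => mid (σ y) (τ c)

/-- A fan over a chain with an antitone involution, whose index type has an involution without
fixed points, is a pseudo-Kleene algebra. -/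
@[reducible]
noncomputable def pseudoKleene [LinearOrder C] (σ : Y → Y) (τ : C → C)
    (hσ : ∀ y, σ (σ y) = y) (hσ' : ∀ y, σ y ≠ y) (hτ : ∀ c, τ (τ c) = c) (hτ' : Antitone τ) :
    PseudoKleeneAlgebra (Fan Y C) :=
  .ofSup sup (invol σ τ)
    (by
      rintro (_ | ⟨y, c⟩ | _) (_ | ⟨z, d⟩ | _) <;> simp [sup]
      split_ifs <;> simp)
    (by
      rintro (_ | ⟨y, c⟩ | _) (_ | ⟨z, d⟩ | _) <;> simp [sup]
      split_ifs <;> simp_all)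
    (by
      rintro (_ | ⟨y, c⟩ | _) (_ | ⟨z, d⟩ | _) (_ | ⟨w, e⟩ | _) <;> simp [sup]
      grind [mid_le_mid])
    (by
      rintro (_ | ⟨y, c⟩ | _) (_ | ⟨z, d⟩ | _) <;> simp [invol]
      rintro rfl h
      exact ⟨rfl, hτ' h⟩)
    (by rintro (_ | ⟨y, c⟩ | _) <;> simp [invol, hσ, hτ])
    (by
      rintro (_ | ⟨y, c⟩ | _) (_ | ⟨z, d⟩ | _) <;> simp [sup, invol, (hσ' _).symm, hσ' _, hσ])

/-- Forgetting the index is a strictly monotone map onto a finite chain of heights, however many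
copies there are. -/
instance [LinearOrder C] [Finite C] : WellFoundedGT (Fan Y C) := by
  let f : Fan Y C → WithBot (WithTop C)
    | bot => ⊥
    | top => ((⊤ : WithTop C) : WithBot (WithTop C))
    | mid _ c => ((c : WithTop C) : WithBot (WithTop C))
  have hf : StrictMono f := by
    rintro (_ | ⟨y, c⟩ | _) (_ | ⟨z, d⟩ | _) h <;>
      rw [lt_iff_le_not_ge] at h <;> simp [f] at h ⊢
    · grind
    · exact WithBot.coe_lt_coe.2 (WithTop.coe_lt_top c)
  have : Finite (WithTop C) := inferInstanceAs (Finite (Option C))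
  have : Finite (WithBot (WithTop C)) := inferInstanceAs (Finite (Option (WithTop C)))
  exact hf.wellFoundedGT

variable {X : Type u} {n : ℕ}

/-- Flipping the Boolean label has no fixed point, so each middle element and its image lie in
different copies and join to the top. -/
noncomputable instance : PseudoKleeneAlgebra (Fan (X × Bool) (Fin n)) :=
  pseudoKleene (Prod.map id not) Fin.rev (by simp) (by simp [Prod.ext_iff]) Fin.rev_rev
    Fin.rev_anti

@[simp] theorem bot_sup' (x : Fan (X × Bool) (Fin n)) : bot ⊔ x = x := bot_sup_eq x
@[simp] theorem sup_bot' (x : Fan (X × Bool) (Fin n)) : x ⊔ bot = x := sup_bot_eq x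
@[simp] theorem top_sup' (x : Fan (X × Bool) (Fin n)) : top ⊔ x = top := top_sup_eq x
@[simp] theorem sup_top' (x : Fan (X × Bool) (Fin n)) : x ⊔ top = top := sup_top_eq x

theorem mid_sup_mid_same (y : X × Bool) (c d : Fin n) :
    mid y c ⊔ mid y d = mid y (max c d) := if_pos rfl

theorem mid_sup_mid_of_ne {y z : X × Bool} (h : y ≠ z) (c d : Fin n) :
    mid y c ⊔ mid z d = top := if_neg h

/-- The congruence of a fan that collapses the copies of the chain indexed by `S`. -/
noncomputable def con (S : Set X) : LatticeCon (Fan (X × Bool) (Fin n)) :=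
  .ofSupInvol
    { r := fun x y => x = y ∨ ∃ a ∈ S, ∃ b c d, x = mid (a, b) c ∧ y = mid (a, b) d
      iseqv := ⟨fun _ => .inl rfl, by grind, by grind⟩ }
    (by
      have key (x y z : Fan (X × Bool) (Fin n))
          (h : x = y ∨ ∃ a ∈ S, ∃ b c d, x = mid (a, b) c ∧ y = mid (a, b) d) :
          x ⊔ z = y ⊔ z ∨ ∃ a ∈ S, ∃ b c d, x ⊔ z = mid (a, b) c ∧ y ⊔ z = mid (a, b) d := by
        obtain rfl | ⟨a, ha, b, c, d, rfl, rfl⟩ := h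
        · exact .inl rfl
        obtain _ | ⟨y, e⟩ | _ := z
        · exact .inr ⟨a, ha, b, c, d, by simp, by simp⟩
        · obtain rfl | h := eq_or_ne (a, b) y
          · exact .inr ⟨a, ha, b, _, _, mid_sup_mid_same _ _ _, mid_sup_mid_same _ _ _⟩
          · exact .inl (by simp only [mid_sup_mid_of_ne h])
        · exact .inl (by simp)
      intro w x y z h h'
      have h1 := key _ _ y h
      have h2 := key _ _ x h'
      rw [sup_comm y, sup_comm z] at h2
      grind)
    (by
      rintro x y (rfl | ⟨a, ha, b, c, d, rfl, rfl⟩)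
      · exact .inl rfl
      · exact .inr ⟨a, ha, !b, c.rev, d.rev, rfl, rfl⟩)

/-- Chains of two elements are the shortest whose collapse is visible; both copies labelled by a
point collapse together, as the involution requires. -/
theorem two_pow_le_mk_involutionCon (X : Type u) :
    2 ^ #X ≤ #(involutionCon (Fan (X × Bool) (Fin 2))) := by
  refine _root_.two_pow_le_mk_involutionCon con (fun S => LatticeCon.ofSupInvol_mem)
    (fun x => mid (x, true) 0) (fun x => mid (x, true) 1) fun S x => ?_
  refine ⟨?_, fun hx => .inr ⟨x, hx, true, 0, 1, rfl, rfl⟩⟩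
  rintro (h | ⟨a, ha, b, c, d, h, -⟩) <;> simp at h
  exact h.1.1 ▸ ha

theorem mk_eq (X : Type u) [Infinite X] (n : ℕ) [NeZero n] :
    #(Fan (X × Bool) (Fin n)) = #X := by
  have hX := aleph0_le_mk X
  let e : Fan (X × Bool) (Fin n) ≃ Option (Option ((X × Bool) × Fin n)) :=
    { toFun := fun | bot => none | top => some none | mid y c => some (some (y, c))
      invFun := fun | none => bot | some none => top | some (some (y, c)) => mid y c
      left_inv := by rintro (_ | _ | _) <;> rfl
      right_inv := by rintro (_ | _ | _) <;> rfl }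
  have hn : (n : Cardinal.{u}) ≤ #X := (natCast_lt_aleph0.trans_le hX).le
  have hn0 : (n : Cardinal.{u}) ≠ 0 := Nat.cast_ne_zero.2 (NeZero.ne n)
  have h2 : (2 : Cardinal.{u}) ≤ #X := ofNat_lt_aleph0.le.trans hX
  rw [mk_congr e]
  simp [mul_eq_left, add_eq_left, hX, hn, hn0, h2, one_le_aleph0.trans hX]

theorem mk_ideal_eq (X : Type u) [Infinite X] (n : ℕ) [NeZero n] :
    #(Ideal (Fan (X × Bool) (Fin n))) = #X := by
  rw [← mk_eq X n]
  refine le_antisymm (mk_le_of_surjective (f := Ideal.principal) fun J => ?_) (mk_le_mk_ideal _)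
  obtain ⟨a, rfl⟩ := J.exists_eq_principal
  exact ⟨a, rfl⟩

end Fan
end Fan

/-! ### Nests: order and join -/

/-- The elements of a nest of copies of `K` indexed by `I`: a core, together with one copy of `K`
for each index. The core and the copies with smaller indices lie inside the later copies, where
each of their elements is a complement of every element other than the bounds. -/
inductive Nest (I K : Type u) : Type u
  | core : Nest I K
  | layer : I → K → Nest I K

namespace Nest

variable {I K : Type u}

section Order

variable [LinearOrder I] [PartialOrder K] [BoundedOrder K]

instance : LE (Nest I K) where
  le
    | core, core => True
    | core, layer _ b => b = ⊤
    | layer _ a, core => a = ⊥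
    | layer i a, layer j b => i = j ∧ a ≤ b ∨ i < j ∧ b = ⊤ ∨ j < i ∧ a = ⊥

variable (i j : I) (a b : K)

@[simp] theorem core_le_core : (core : Nest I K) ≤ core := trivial
@[simp] theorem core_le_layer : core ≤ layer i a ↔ a = ⊤ := Iff.rfl
@[simp] theorem layer_le_core : layer i a ≤ core ↔ a = ⊥ := Iff.rfl
theorem layer_le_layer : layer i a ≤ layer j b ↔
    i = j ∧ a ≤ b ∨ i < j ∧ b = ⊤ ∨ j < i ∧ a = ⊥ := Iff.rfl

variable [Nontrivial K]

instance : PartialOrder (Nest I K) where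
  le_refl x := by cases x <;> simp [layer_le_layer]
  le_trans := by
    have h := bot_ne_top (α := K)
    have h1 (a : K) : a ≤ ⊤ := le_top
    have h2 (a : K) : ⊥ ≤ a := bot_le
    have h3 (a b c : K) : a ≤ b → b ≤ c → a ≤ c := le_trans
    have h4 (a : K) : ⊤ ≤ a → a = ⊤ := top_le_iff.1
    have h5 (a : K) : a ≤ ⊥ → a = ⊥ := le_bot_iff.1
    rintro (_ | ⟨i, a⟩) (_ | ⟨j, b⟩) (_ | ⟨k, c⟩) <;>
      simp only [layer_le_layer, core_le_core, core_le_layer, layer_le_core] <;> grind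
  le_antisymm := by
    have h := bot_ne_top (α := K)
    rintro (_ | ⟨i, a⟩) (_ | ⟨j, b⟩) <;>
      simp only [layer_le_layer, core_le_core, core_le_layer, layer_le_core] <;> grind

instance [OrderTop I] : BoundedOrder (Nest I K) where
  bot := layer ⊤ ⊥
  bot_le := by
    rintro (_ | ⟨i, a⟩)
    · simp
    · simp [layer_le_layer, eq_comm, ← le_iff_eq_or_lt]
  top := layer ⊤ ⊤
  le_top := by
    rintro (_ | ⟨i, a⟩)
    · simp
    · simp [layer_le_layer, ← le_iff_eq_or_lt]

end Order

section Sup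

variable [LinearOrder I] [Lattice K] [BoundedOrder K]

open Classical in
/-- The join in a nest. -/
noncomputable def sup : Nest I K → Nest I K → Nest I K
  | core, core => core
  | core, layer j b => if b = ⊥ then core else layer j ⊤
  | layer i a, core => if a = ⊥ then core else layer i ⊤
  | layer i a, layer j b =>
    if i < j then if b = ⊥ then layer i a else layer j ⊤
    else if j < i then if a = ⊥ then layer j b else layer i ⊤
    else layer i (a ⊔ b)

theorem le_sup_left' (x y : Nest I K) : x ≤ sup x y := by
  obtain _ | ⟨i, a⟩ := x <;> obtain _ | ⟨j, b⟩ := y <;> simp only [sup] <;> (try split_ifs) <;>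
    simp_all [layer_le_layer]

theorem le_sup_right' (x y : Nest I K) : y ≤ sup x y := by
  obtain _ | ⟨i, a⟩ := x <;> obtain _ | ⟨j, b⟩ := y <;> simp only [sup] <;> (try split_ifs) <;>
    simp_all [layer_le_layer]
  grind

theorem sup_le' [Nontrivial K] (x y z : Nest I K) (hx : x ≤ z) (hy : y ≤ z) : sup x y ≤ z := by
  have h := bot_ne_top (α := K)
  have h1 (a : K) : a ≤ ⊤ := le_top
  have h3 (a b c : K) : a ≤ c → b ≤ c → a ⊔ b ≤ c := sup_le
  have h4 (a : K) : ⊤ ≤ a → a = ⊤ := top_le_iff.1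
  have h5 (a : K) : a ≤ ⊥ → a = ⊥ := le_bot_iff.1
  have h6 : (⊥ : K) ⊔ ⊥ = ⊥ := sup_idem _
  obtain _ | ⟨i, a⟩ := x <;> obtain _ | ⟨j, b⟩ := y <;> obtain _ | ⟨k, c⟩ := z <;>
    simp only [sup] <;> (try split_ifs) <;>
    simp only [layer_le_layer, core_le_core, core_le_layer, layer_le_core] at * <;> grind

end Sup

/-- The map induced on a nest by a map of the layers. -/
def map (f : K → K) : Nest I K → Nest I K
  | core => core
  | layer i a => layer i (f a)

end Nest


/-! ### Separative ortholattices -/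

/-- The ortholattices with more than two elements in which any two elements `a < b` are separated
by a nonzero element that is disjoint from `a` and lies below `b`. -/
class SeparativeOrtholattice (K : Type u) [PseudoKleeneAlgebra K] : Prop where
  sup_invol : ∀ a : K, a ⊔ invol a = ⊤
  exists_ne : ∃ a : K, a ≠ ⊥ ∧ a ≠ ⊤
  exists_disjoint : ∀ a b : K, a < b → ∃ c, c ≠ ⊥ ∧ c ≤ b ∧ a ⊓ c = ⊥

section PseudoKleene

variable {K : Type u} [PseudoKleeneAlgebra K]

theorem invol_bot : invol (⊥ : K) = ⊤ :=
  top_le_iff.1 (by simpa [invol_invol] using invol_le_invol (L := K) _ _ (bot_le (a := invol ⊤)))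

theorem invol_top : invol (⊤ : K) = ⊥ := by rw [← invol_bot, invol_invol]

theorem invol_eq_bot {a : K} : invol a = ⊥ ↔ a = ⊤ :=
  ⟨fun h => by rw [← invol_invol a, h, invol_bot], fun h => by rw [h, invol_top]⟩

theorem invol_eq_top {a : K} : invol a = ⊤ ↔ a = ⊥ :=
  ⟨fun h => by rw [← invol_invol a, h, invol_top], fun h => by rw [h, invol_bot]⟩

variable [SeparativeOrtholattice K]

theorem inf_invol_eq_bot (a : K) : a ⊓ invol a = ⊥ := by
  rw [← invol_sup_invol, invol_invol, sup_comm, SeparativeOrtholattice.sup_invol, invol_top]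

instance SeparativeOrtholattice.nontrivial : Nontrivial K :=
  let ⟨a, ha, _⟩ := exists_ne (K := K)
  ⟨a, ⊥, ha⟩

end PseudoKleene

/-! ### The involution of a nest and relative complements in its layers -/

namespace Nest

section Position

variable {I K : Type u} [LinearOrder I] {i : I} {a b : K} {x : Nest I K} {U : LowerSet I}

/-- The elements of a nest that lie strictly inside the layer `i`. -/
def Inside (i : I) : Nest I K → Prop
  | core => True
  | layer j _ => j < i

/-- The part of a nest that consists of the core and of the layers with index in `U`. -/
def InRegion (U : LowerSet I) : Nest I K → Prop
  | core => True
  | layer i _ => i ∈ U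

theorem inside_core : Inside i (core : Nest I K) := trivial

theorem InRegion.inside (hx : InRegion U x) (hi : i ∉ U) : Inside i x := by
  obtain _ | ⟨j, b⟩ := x
  · trivial
  · exact not_le.1 fun h => hi (U.lower h hx)

variable [PartialOrder K] [BoundedOrder K]

theorem Inside.bot_le (h : Inside i x) : layer i ⊥ ≤ x := by
  obtain _ | ⟨j, b⟩ := x
  · rfl
  · exact .inr (.inr ⟨h, rfl⟩)

theorem Inside.le_top (h : Inside i x) : x ≤ layer i ⊤ := by
  obtain _ | ⟨j, b⟩ := x
  · rfl
  · exact .inr (.inl ⟨h, rfl⟩)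

theorem layer_le_layer_iff : layer i a ≤ layer i b ↔ a ≤ b := by simp [layer_le_layer]

end Position

variable {I K : Type u} [LinearOrder I] [OrderTop I] [PseudoKleeneAlgebra K]
  [SeparativeOrtholattice K]

noncomputable instance : PseudoKleeneAlgebra (Nest I K) :=
  .ofSup sup (map invol) le_sup_left' le_sup_right' sup_le'
    (by
      have h := @invol_le_invol K _
      rintro (_ | ⟨i, a⟩) (_ | ⟨j, b⟩) <;>
        simp only [map, layer_le_layer, core_le_core, core_le_layer, layer_le_core, invol_eq_bot,
          invol_eq_top] <;> grind)
    (by rintro (_ | ⟨i, a⟩) <;> simp [map, invol_invol])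
    (by
      intro x y
      -- The core is fixed by the involution and separates all `x ⊓ x'` from all `y ⊔ y'`.
      trans core
      · obtain _ | ⟨i, a⟩ := x
        · exact core_le_core
        · simp [map, sup, SeparativeOrtholattice.sup_invol, invol_top]
      · obtain _ | ⟨i, a⟩ := y
        · exact core_le_core
        · simp [map, sup, SeparativeOrtholattice.sup_invol])

section Operations

variable {i j : I} {a b : K} {x y : Nest I K} {U : LowerSet I}

theorem invol_layer : invol (layer i a) = layer i (invol a) := rfl

theorem Inside.invol (h : Inside i x) : Inside i (invol x) := by
  obtain _ | ⟨j, b⟩ := x <;> exact h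

theorem InRegion.invol (h : InRegion U x) : InRegion U (invol x) := by
  obtain _ | ⟨j, b⟩ := x <;> exact h

theorem layer_sup_layer : layer i a ⊔ layer i b = layer i (a ⊔ b) := by
  change sup _ _ = _
  simp [sup]

theorem layer_inf_layer : layer i a ⊓ layer i b = layer i (a ⊓ b) := by
  rw [← invol_sup_invol, invol_layer, invol_layer, layer_sup_layer, invol_layer, invol_sup_invol]

theorem Inside.sup_layer (h : Inside i x) (ha : a ≠ ⊥) : x ⊔ layer i a = layer i ⊤ := by
  obtain _ | ⟨j, b⟩ := x
  · exact if_neg ha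
  · exact (if_pos h).trans (if_neg ha)

theorem Inside.inf_layer (h : Inside i x) (ha : a ≠ ⊤) : x ⊓ layer i a = layer i ⊥ := by
  rw [← invol_sup_invol, invol_layer, h.invol.sup_layer (mt invol_eq_bot.1 ha), invol_layer,
    invol_top]

theorem InRegion.sup (hx : InRegion U x) (hy : InRegion U y) : InRegion U (x ⊔ y) := by
  change InRegion U (Nest.sup x y)
  obtain _ | ⟨i, a⟩ := x <;> obtain _ | ⟨j, b⟩ := y <;> simp only [Nest.sup] <;>
    (try split_ifs) <;> assumption

end Operations

/-! ### Congruences of a nest are lower sets of indices -/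

section Congruences

/-- The congruence of a nest that collapses the core and the layers with index in `U`. -/
noncomputable def con (U : LowerSet I) : LatticeCon (Nest I K) :=
  .ofSupInvol
    { r := fun x y => x = y ∨ InRegion U x ∧ InRegion U y
      iseqv := ⟨fun _ => .inl rfl, by grind, by grind⟩ }
    (by
      have key (x y z : Nest I K) (h : x = y ∨ InRegion U x ∧ InRegion U y) :
          x ⊔ z = y ⊔ z ∨ InRegion U (x ⊔ z) ∧ InRegion U (y ⊔ z) := by
        obtain rfl | ⟨hx, hy⟩ := h
        · exact .inl rfl
        -- Outside the region, `z` absorbs the difference: it is either below both elements, as the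
        -- bottom of its layer, or joins both to the top of its layer.
        by_cases hz : InRegion U z
        · exact .inr ⟨hx.sup hz, hy.sup hz⟩
        obtain _ | ⟨i, a⟩ := z
        · exact (hz trivial).elim
        obtain rfl | ha := eq_or_ne a ⊥
        · rw [sup_eq_left.2 (hx.inside hz).bot_le, sup_eq_left.2 (hy.inside hz).bot_le]
          exact .inr ⟨hx, hy⟩
        · rw [(hx.inside hz).sup_layer ha, (hy.inside hz).sup_layer ha]
          exact .inl rfl
      intro w x y z h h'
      have h1 := key _ _ y h
      have h2 := key _ _ x h'
      rw [sup_comm y, sup_comm z] at h2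
      grind)
    (by
      rintro x y (rfl | ⟨hx, hy⟩)
      · exact .inl rfl
      · exact .inr ⟨hx.invol, hy.invol⟩)

variable (θ : LatticeCon (Nest I K)) {i j : I} {a b : K} {x y : Nest I K}

variable {θ} in
theorem rel_bot_of_collapsed (h : θ.r (layer i ⊥) (layer i ⊤)) (hx : layer i ⊥ ≤ x)
    (hx' : x ≤ layer i ⊤) : θ.r (layer i ⊥) x := by
  simpa [inf_eq_left.2 hx, inf_eq_right.2 hx'] using θ.inf h (θ.refl x)

/-- The indices of the layers that are collapsed by a congruence. -/
def collapsed : LowerSet I where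
  carrier := {i | θ.r (layer i ⊥) (layer i ⊤)}
  lower' i j hji h := by
    obtain rfl | hji := hji.eq_or_lt
    · exact h
    have hj (a : K) : Inside i (layer j a) := hji
    exact θ.trans (θ.symm (rel_bot_of_collapsed h (hj _).bot_le (hj _).le_top))
      (rel_bot_of_collapsed h (hj _).bot_le (hj _).le_top)

theorem rel_core_of_inRegion (hx : InRegion (collapsed θ) x) : θ.r x core := by
  obtain _ | ⟨i, a⟩ := x
  · exact θ.refl _
  · exact θ.trans (θ.symm (rel_bot_of_collapsed hx (layer_le_layer_iff.2 bot_le)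
      (layer_le_layer_iff.2 le_top)))
      (rel_bot_of_collapsed hx inside_core.bot_le inside_core.le_top)

variable {θ}

/-- Meeting with any `c ≠ ⊤` of the layer turns the relation into `⊥ ~ c`. Applying this to a
nontrivial `b` and its complement and joining gives `⊥ ~ ⊤`. -/
theorem mem_collapsed_of_rel_top (hx : Inside i x) (h : θ.r x (layer i ⊤)) : i ∈ collapsed θ := by
  obtain ⟨b, hb, hb'⟩ := SeparativeOrtholattice.exists_ne (K := K)
  have key (c : K) (hc : c ≠ ⊤) : θ.r (layer i ⊥) (layer i c) := by
    simpa [hx.inf_layer hc, layer_inf_layer] using θ.inf h (θ.refl (layer i c))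
  have := θ.sup (key b hb') (key (invol b) (mt invol_eq_top.1 hb))
  rwa [layer_sup_layer, layer_sup_layer, sup_idem, SeparativeOrtholattice.sup_invol] at this

theorem mem_collapsed_of_rel_bot (hx : Inside i x) (h : θ.r x (layer i ⊥)) : i ∈ collapsed θ := by
  obtain ⟨b, hb, hb'⟩ := SeparativeOrtholattice.exists_ne (K := K)
  have key (c : K) (hc : c ≠ ⊥) : θ.r (layer i c) (layer i ⊤) := by
    simpa [hx.sup_layer hc, layer_sup_layer] using θ.sup (θ.symm h) (θ.refl (layer i c))
  have := θ.inf (key b hb) (key (invol b) (mt invol_eq_bot.1 hb'))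
  rwa [layer_inf_layer, layer_inf_layer, inf_idem, inf_invol_eq_bot] at this

theorem mem_collapsed_of_rel (hx : Inside i x) (h : θ.r x (layer i a)) : i ∈ collapsed θ := by
  obtain rfl | ha := eq_or_ne a ⊥
  · exact mem_collapsed_of_rel_bot hx h
  obtain rfl | ha' := eq_or_ne a ⊤
  · exact mem_collapsed_of_rel_top hx h
  -- Meeting with `a` relates the bottom of the layer to `a`; joining with the core then relates the
  -- core to the top.
  have h1 := θ.inf h (θ.refl (layer i a))
  rw [hx.inf_layer ha', inf_idem] at h1
  have h2 := θ.sup (θ.refl core) h1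
  rw [inside_core.sup_layer ha, sup_eq_left.2 inside_core.bot_le] at h2
  exact mem_collapsed_of_rel_top inside_core h2

/-- Separativity gives a nonzero `c` below `a ⊔ b` and disjoint from `a ⊓ b`. Meeting with it yields
`⊥ ~ c`, and joining with the core relates the core to the top of the layer. -/
theorem mem_collapsed_of_rel_layer (hab : a ≠ b) (h : θ.r (layer i a) (layer i b)) :
    i ∈ collapsed θ := by
  obtain ⟨c, hc, hcb, hac⟩ := SeparativeOrtholattice.exists_disjoint _ _ (inf_lt_sup.2 hab)
  have h1 := θ.inf (θ.r_inf_sup_iff.2 h) (θ.refl (layer i c))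
  rw [layer_inf_layer, layer_inf_layer, layer_sup_layer, layer_inf_layer, hac,
    inf_eq_right.2 hcb] at h1
  have h2 := θ.sup (θ.refl core) h1
  rw [inside_core.sup_layer hc, sup_eq_left.2 inside_core.bot_le] at h2
  exact mem_collapsed_of_rel_top inside_core h2

theorem inRegion_of_rel_layer (h : θ.r x (layer i a)) (hne : x ≠ layer i a)
    (hx : ∀ j b, x = layer j b → j ≤ i) : InRegion (collapsed θ) x ∧ i ∈ collapsed θ := by
  obtain _ | ⟨j, b⟩ := x
  · exact ⟨trivial, mem_collapsed_of_rel inside_core h⟩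
  obtain rfl | hji := (hx j b rfl).eq_or_lt
  · have := mem_collapsed_of_rel_layer (fun hab => hne (by rw [hab])) h
    exact ⟨this, this⟩
  · have := mem_collapsed_of_rel (x := layer j b) hji h
    exact ⟨(collapsed θ).lower hji.le this, this⟩

variable (θ) in
theorem con_collapsed : con (collapsed θ) = θ := by
  refine LatticeCon.ext_r fun x y => ⟨?_, fun h => ?_⟩
  · rintro (rfl | ⟨hx, hy⟩)
    · exact θ.refl _
    · exact θ.trans (rel_core_of_inRegion θ hx) (θ.symm (rel_core_of_inRegion θ hy))
  · by_cases hne : x = y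
    · exact .inl hne
    refine .inr ?_
    obtain _ | ⟨i, a⟩ := x <;> obtain _ | ⟨j, b⟩ := y
    · exact (hne rfl).elim
    · exact inRegion_of_rel_layer h hne (by simp)
    · exact (inRegion_of_rel_layer (θ.symm h) (Ne.symm hne) (by simp)).symm
    · obtain hij | hij := le_total i j
      · exact inRegion_of_rel_layer h hne (by rintro _ _ ⟨⟩; exact hij)
      · exact (inRegion_of_rel_layer (θ.symm h) (Ne.symm hne) (by rintro _ _ ⟨⟩; exact hij)).symm

theorem collapsed_con (U : LowerSet I) : collapsed (con U : LatticeCon (Nest I K)) = U := by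
  refine SetLike.ext fun i => ⟨?_, fun h => Or.inr ⟨h, h⟩⟩
  rintro (h | h)
  · simp at h
  · exact h.1

variable (I K)

theorem mk_latticeCon : #(LatticeCon (Nest I K)) = #(LowerSet I) :=
  mk_congr ⟨collapsed, con, con_collapsed, collapsed_con⟩

theorem involutionCon_eq_univ : involutionCon (Nest I K) = Set.univ := by
  refine Set.eq_univ_of_forall fun θ => ?_
  rw [← con_collapsed θ]
  exact LatticeCon.ofSupInvol_mem

end Congruences

/-! ### Size and ideals of a nest -/

section Cardinality

variable (I K)

omit [LinearOrder I] [OrderTop I] [PseudoKleeneAlgebra K] [SeparativeOrtholattice K] in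
theorem mk_eq : #(Nest I K) = #I * #K + 1 := by
  let e : Nest I K ≃ Option (I × K) :=
    { toFun := fun | core => none | layer i a => some (i, a)
      invFun := fun | none => core | some (i, a) => layer i a
      left_inv := by rintro (_ | _) <;> rfl
      right_inv := by rintro (_ | _) <;> rfl }
  rw [mk_congr e, mk_option, mk_prod, lift_id, lift_id]

theorem mk_ideal_layer_le : #(Ideal K) ≤ #(Ideal (Nest I K)) :=
  mk_ideal_le_of_sup_embedding (layer ⊤) (fun _ _ => layer_sup_layer.symm)
    fun _ _ => layer_le_layer_iff.1

variable {I K}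

/-- The elements of a layer that lie in an ideal of a nest form an ideal. -/
def layerIdeal (J : Ideal (Nest I K)) (i : I) (h : layer i ⊥ ∈ J) : Ideal K where
  carrier := {a | layer i a ∈ J}
  lower' _ _ hba ha := J.lower (layer_le_layer_iff.2 hba) ha
  nonempty' := ⟨⊥, h⟩
  directed' a ha b hb := ⟨a ⊔ b, by
    change layer i (a ⊔ b) ∈ J
    rw [← layer_sup_layer]
    exact Ideal.sup_mem ha hb, le_sup_left, le_sup_right⟩

/-- If `J` contains the core, one nonzero element of a layer already forces its top into `J`, so `J`
is determined by the layers it contains. Otherwise the least layer `t` whose bottom lies in `J` has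
the largest such bottom, and `J` is generated by its part in that layer: a nonzero element further
out would join with the bottom of `t` to an element above the core. -/
theorem ideal_eq_principal_or [WellFoundedLT I] (hK : ∀ J : Ideal K, ∃ a, J = Ideal.principal a)
    (J : Ideal (Nest I K)) : (∃ x, J = Ideal.principal x) ∨
      ∃ U : LowerSet I, ∀ x, x ∈ J ↔ InRegion U x ∨ ∃ i, x = layer i ⊥ := by
  by_cases hJ : core ∈ J
  · let U : LowerSet I :=
      { carrier := {i | layer i ⊤ ∈ J}
        lower' := fun i j hji h => by
          obtain rfl | hji := hji.eq_or_lt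
          · exact h
          · exact J.lower (Inside.le_top (x := layer j ⊤) hji) h }
    refine .inr ⟨U, fun x => ⟨fun hx => ?_, ?_⟩⟩
    · obtain _ | ⟨i, a⟩ := x
      · exact .inl trivial
      obtain rfl | ha := eq_or_ne a ⊥
      · exact .inr ⟨i, rfl⟩
      · refine .inl (?_ : layer i ⊤ ∈ J)
        rw [← inside_core.sup_layer ha]
        exact Ideal.sup_mem hJ hx
    · rintro (hx | ⟨i, rfl⟩)
      · obtain _ | ⟨i, a⟩ := x
        · exact hJ
        · exact J.lower (layer_le_layer_iff.2 le_top) hx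
      · exact J.lower inside_core.bot_le hJ
  · have hne : ∃ i, layer i ⊥ ∈ J := by
      obtain ⟨_ | ⟨i, a⟩, hx⟩ := J.nonempty
      · exact (hJ hx).elim
      · exact ⟨i, J.lower (layer_le_layer_iff.2 bot_le) hx⟩
    obtain ⟨t, ht, hmin⟩ := wellFounded_lt.has_min {i | layer i ⊥ ∈ J} hne
    obtain ⟨m, hm⟩ := hK (layerIdeal J t ht)
    have hm (a : K) : layer t a ∈ J ↔ a ≤ m := by
      rw [← Ideal.mem_principal, ← hm]
      rfl
    refine .inl ⟨layer t m, SetLike.ext fun x => ?_⟩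
    rw [Ideal.mem_principal]
    refine ⟨fun hx => ?_, fun hx => J.lower hx ((hm m).2 le_rfl)⟩
    obtain _ | ⟨i, a⟩ := x
    · exact (hJ hx).elim
    obtain rfl | hti := (not_lt.1 (hmin i (J.lower (layer_le_layer_iff.2 bot_le) hx))).eq_or_lt
    · exact layer_le_layer_iff.2 ((hm a).1 hx)
    obtain rfl | ha := eq_or_ne a ⊥
    · exact Inside.bot_le (x := layer t m) hti
    refine (hJ (J.lower (inside_core (i := i)).le_top ?_)).elim
    rw [← Inside.sup_layer (x := layer t ⊥) hti ha]
    exact Ideal.sup_mem ht hx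

theorem mk_ideal_le [WellFoundedLT I] (hK : ∀ J : Ideal K, ∃ a, J = Ideal.principal a) :
    #(Ideal (Nest I K)) ≤ #(Nest I K) + #(LowerSet I) := by
  rw [add_def]
  let P (s : Nest I K ⊕ LowerSet I) (J : Ideal (Nest I K)) : Prop :=
    s.elim (fun x => J = Ideal.principal x)
      fun U => ∀ x, x ∈ J ↔ InRegion U x ∨ ∃ i, x = layer i ⊥
  have h (J : Ideal (Nest I K)) : ∃ s, P s J := by
    obtain ⟨x, hx⟩ | ⟨U, hU⟩ := ideal_eq_principal_or hK J
    · exact ⟨.inl x, hx⟩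
    · exact ⟨.inr U, hU⟩
  choose f hf using h
  refine mk_le_of_injective (f := f) fun J J' hJ => ?_
  have h := hf J
  have h' := hf J'
  rw [← hJ] at h'
  generalize f J = s at h h'
  obtain x | U := s
  · exact Eq.trans h (Eq.symm h')
  · exact SetLike.ext fun x => (h x).trans (h' x).symm

end Cardinality

end Nest

/-! ### The two kinds of layers and the final choice -/

instance (X : Type u) [Nontrivial X] : SeparativeOrtholattice (finiteCofinite X) where
  sup_invol a := sup_compl_eq_top
  exists_ne := by
    obtain ⟨x, y, hxy⟩ := exists_pair_ne X
    refine ⟨⟨{x}, finiteCofinite_singleton_mem x⟩, fun h => ?_, fun h => ?_⟩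
    · exact Set.singleton_ne_empty x (congrArg Subtype.val h)
    · have h : {x} = Set.univ := congrArg Subtype.val h
      exact hxy (Set.mem_singleton_iff.1 (h ▸ Set.mem_univ y)).symm
  exists_disjoint a b hab :=
    ⟨b \ a, fun h => hab.not_ge (sdiff_eq_bot_iff.1 h), sdiff_le, inf_sdiff_self_right⟩

instance (X : Type u) [Nonempty X] : SeparativeOrtholattice (Fan (X × Bool) (Fin 1)) where
  sup_invol := by
    rintro (_ | ⟨⟨x, b⟩, c⟩ | _)
    · rfl
    · exact Fan.mid_sup_mid_of_ne (by simp [Prod.ext_iff]) _ _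
    · rfl
  exists_ne := ⟨.mid (Classical.arbitrary X, true) 0, by rintro ⟨⟩, by rintro ⟨⟩⟩
  exists_disjoint := by
    rintro (_ | ⟨⟨x, b⟩, c⟩ | _) b' hab
    · exact ⟨b', hab.ne', le_rfl, bot_inf_eq b'⟩
    · obtain _ | ⟨z, d⟩ | _ := b'
      · exact (hab.not_ge bot_le).elim
      · obtain ⟨rfl, -⟩ := hab.le
        rw [Subsingleton.elim c d] at hab
        exact (lt_irrefl _ hab).elim
      · refine ⟨.mid (x, !b) 0, by rintro ⟨⟩, le_top, ?_⟩
        rw [← invol_sup_invol, ← invol_top (K := Fan (X × Bool) (Fin 1))]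
        exact congrArg invol (Fan.mid_sup_mid_of_ne (by simp [Prod.ext_iff]) _ _)
    · exact (hab.not_ge le_top).elim

/-- If the ortholattice `K` has `ν` elements and `μ` ideals, where `μ` is `ν` and all ideals are
principal, or `μ` is `2 ^ ν`, then every cardinal `κ` with `2 ≤ κ ≤ ν` is the number of congruences
of a nest of copies of `K` with `ν` elements and `μ` ideals. -/
theorem exists_nest (K : Type u) [PseudoKleeneAlgebra K] [SeparativeOrtholattice K]
    (κ : Cardinal.{u}) (hν : ℵ₀ ≤ #K) (h2 : 2 ≤ κ) (hκ : κ ≤ #K)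
    (hK : (∀ J : Ideal K, ∃ a, J = Ideal.principal a) ∨ #(Ideal K) = 2 ^ #K) :
    ∃ (L : Type u) (_ : PseudoKleeneAlgebra L), #L = #K ∧ #(Ideal L) = #(Ideal K) ∧
      #(LatticeCon L) = κ ∧ involutionCon L = Set.univ := by
  -- Write `κ = 2 + c`: one unit is the added greatest index, which bounds the nest, the other the
  -- extra lower set. This covers finite `κ` as well.
  obtain ⟨c, rfl⟩ := exists_add_of_le h2
  obtain ⟨_, _⟩ := exists_wellFoundedLT c.out
  have hI : #(WithTop c.out) = c + 1 :=
    (mk_option (α := c.out)).trans (by rw [mk_out])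
  have hI' : #(LowerSet (WithTop c.out)) = 2 + c := by
    rw [mk_lowerSet, hI, add_assoc, one_add_one_eq_two, add_comm]
  have hcν : c + 1 ≤ #K := by
    refine le_trans ?_ hκ
    rw [add_comm]
    gcongr
    exact one_le_two
  have hL : #(Nest (WithTop c.out) K) = #K := by
    rw [Nest.mk_eq, hI, mul_eq_right hν hcν (by simp), add_one_eq hν]
  refine ⟨Nest (WithTop c.out) K, inferInstance, hL, ?_, ?_, Nest.involutionCon_eq_univ _ _⟩
  · refine le_antisymm ?_ (Nest.mk_ideal_layer_le _ _)
    obtain hK | hK := hK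
    · refine (Nest.mk_ideal_le hK).trans ?_
      rw [hL, hI', add_eq_left hν hκ]
      exact mk_le_mk_ideal K
    · rw [hK, ← hL]
      exact mk_ideal_le _
  · rw [Nest.mk_latticeCon, hI']

theorem theorem4p9 (ν κ μ : Cardinal.{u}) (hν : Cardinal.aleph0 ≤ ν)
    (hκ : (2 ≤ κ ∧ κ ≤ ν) ∨ κ = 2 ^ ν) (hμ : μ = ν ∨ μ = 2 ^ ν) :
    ∃ (L : Type u) (_ : PseudoKleeneAlgebra L),
      Cardinal.mk L = ν ∧
      Cardinal.mk (Order.PFilter L) = μ ∧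
      Cardinal.mk (Order.Ideal L) = μ ∧
      Cardinal.mk (LatticeCon L) = κ ∧
      Cardinal.mk (involutionCon L) = κ ∧
      (κ ≤ ν → involutionCon L = Set.univ) := by
  obtain ⟨X, rfl⟩ : ∃ X : Type u, #X = ν := ⟨ν.out, mk_out ν⟩
  have : Infinite X := infinite_iff.2 hν
  obtain ⟨h2, hκ⟩ | rfl := hκ
  · suffices h : ∃ (L : Type u) (_ : PseudoKleeneAlgebra L), #L = #X ∧ #(Ideal L) = μ ∧
        #(LatticeCon L) = κ ∧ involutionCon L = Set.univ by
      obtain ⟨L, _, hL, hid, hcon, huniv⟩ := h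
      refine ⟨L, ‹_›, hL, ?_, hid, hcon, ?_, fun _ => huniv⟩
      · rw [mk_pfilter_eq_mk_ideal, hid]
      · rw [huniv, mk_univ, hcon]
    obtain rfl | rfl := hμ
    · have h := exists_nest (Fan (X × Bool) (Fin 1)) κ
      rw [Fan.mk_eq, Fan.mk_ideal_eq] at h
      exact h hν h2 hκ (.inl fun J => J.exists_eq_principal)
    · have h := exists_nest (finiteCofinite X) κ
      rw [mk_finiteCofinite, mk_ideal_finiteCofinite] at h
      exact h hν h2 hκ (.inr rfl)
  · suffices h : ∃ (L : Type u) (_ : PseudoKleeneAlgebra L), #L = #X ∧ #(Ideal L) = μ ∧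
        2 ^ #X ≤ #(involutionCon L) by
      obtain ⟨L, _, hL, hid, hcon⟩ := h
      have hle : #(LatticeCon L) ≤ 2 ^ #X := hL ▸ mk_latticeCon_le L (hL ▸ hν)
      refine ⟨L, ‹_›, hL, ?_, hid, le_antisymm hle (hcon.trans (mk_set_le _)),
        -- The last clause is vacuous here, since `2 ^ ν ≤ ν` contradicts Cantor's theorem.
        le_antisymm ((mk_set_le _).trans hle) hcon, fun h => (h.not_gt (cantor _)).elim⟩
      rw [mk_pfilter_eq_mk_ideal, hid]
    obtain rfl | rfl := hμ
    · exact ⟨_, inferInstance, Fan.mk_eq X 2, Fan.mk_ideal_eq X 2,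
        Fan.two_pow_le_mk_involutionCon X⟩
    · exact ⟨_, inferInstance, mk_finiteCofinite X, mk_ideal_finiteCofinite X,
        two_pow_le_mk_involutionCon_finiteCofinite X⟩
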